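/- Let $\mathcal H$ be a complex Hilbert space and let $\{W_t\}_{t\ge 0}$ be a strongly continuous one-parameter semigroup of contractions on $\mathcal H$ with infinitesimal generator $A$ and cogenerator $W=(A+I)(A-I)^{-1}$, and suppose that $\operatorname{Ker}W=\{0\}$. A quasi-affinity is an injective bounded linear operator with dense range. A strongly continuous unitary group $\{U'_t\}_{t\in\mathbb R}$ on a Hilbert space $\mathcal H'$ is called a unitary quasi-affine transform of $\{W_t\}_{t\ge0}$ if there is a quasi-affinity $\Lambda:\mathcal H'\to\mathcal H$ with $\Lambda U'_t=W_t\Lambda$ for all $t\ge 0$. The following statements are equivalent: (i) $\{W_t\}_{t\ge0}$ has a unitary quasi-affine transform; (ii) $\{W_t\}_{t\ge0}$ is of class $C_{\cdot1}$, i.e. for each non-zero $h\in\mathcal H$, $W_t^*h$ does not converge to $0$ as $t\to\infty$. Suppose that this is the case. Then $\{W_t\}_{t\ge0}$ has a minimal unitary dilation, i.e. a strongly continuous unitary group $\{U_t\}_{t\in\mathbb R}$ on a Hilbert space $\mathcal K\supset\mathcal H$ such that $W_th=P_{\mathcal H}U_th$ for all $t\ge0$ and $h\in\mathcal H$, and $\mathcal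 K=\bigvee_{t\in\mathbb R}U_t\mathcal H$ (closed linear span). For every such dilation, put $$\mathcal K_+=\bigvee_{t\ge0}U_t\mathcal H,\qquad \mathcal R=\bigcap_{t\ge0}U_t\mathcal K_+,\qquad R_t=U_t|_{\mathcal R}\quad(t\in\mathbb R).$$ Then the residual group $\{R_t\}_{t\in\mathbb R}$ is a unitary quasi-affine transform of $\{W_t\}_{t\ge0}$, and $\Lambda_0=P_{\mathcal H}|_{\mathcal R}:\mathcal R\to\mathcal H$ is a quasi-affinity with $\Lambda_0R_t=W_t\Lambda_0$ for every $t\ge0$. Here $P_{\mathcal H}$ denotes the orthogonal projection of $\mathcal K$ onto $\mathcal H$. -/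

import Mathlib

open Filter Topology
open scoped NNReal

universe u v

noncomputable section

namespace QuasiAffine

section Operators

variable {H₁ : Type*} [NormedAddCommGroup H₁] [InnerProductSpace ℂ H₁]
variable {H₂ : Type*} [NormedAddCommGroup H₂] [InnerProductSpace ℂ H₂]

/-- The intertwining set of two bounded operators: all bounded `Λ` with `Λ A = B Λ`. -/
def intertwiningSet (A : H₁ →L[ℂ] H₁) (B : H₂ →L[ℂ] H₂) : Set (H₁ →L[ℂ] H₂) :=
  {Λ | Λ ∘L A = B ∘L Λ}

/-- A quasi-affinity: an injective bounded operator with dense range. -/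
def IsQuasiAffinity (Λ : H₁ →L[ℂ] H₂) : Prop :=
  Function.Injective Λ ∧ DenseRange Λ

end Operators

section Semigroups

variable {H : Type*} [NormedAddCommGroup H] [InnerProductSpace ℂ H]

/-- A strongly continuous one-parameter semigroup of contractions. -/
structure IsContractionSemigroup (W : ℝ≥0 → H →L[ℂ] H) : Prop where
  map_zero : W 0 = ContinuousLinearMap.id ℂ H
  map_add : ∀ t s, W (t + s) = W t ∘L W s
  continuous : ∀ h, Continuous fun t => W t h
  contraction : ∀ t, ‖W t‖ ≤ 1

/-- A strongly continuous one-parameter group of unitary operators. -/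
structure IsUnitaryGroup (U : ℝ → H ≃ₗᵢ[ℂ] H) : Prop where
  map_zero : ∀ h, U 0 h = h
  map_add : ∀ t s h, U (t + s) h = U t (U s h)
  continuous : ∀ h, Continuous fun t => U t h

/-- `y` is the right derivative at `0` of the orbit `t ↦ W t x`. -/
def HasGenerator (W : ℝ≥0 → H →L[ℂ] H) (x y : H) : Prop :=
  Tendsto (fun t : ℝ≥0 => ((t : ℝ) : ℂ)⁻¹ • (W t x - x)) (𝓝[>] 0) (𝓝 y)

theorem HasGenerator.unique {W : ℝ≥0 → H →L[ℂ] H} {x y z : H}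
    (hy : HasGenerator W x y) (hz : HasGenerator W x z) : y = z :=
  tendsto_nhds_unique hy hz

theorem HasGenerator.add {W : ℝ≥0 → H →L[ℂ] H} {x y x' y' : H}
    (h : HasGenerator W x y) (h' : HasGenerator W x' y') :
    HasGenerator W (x + x') (y + y') := by
  refine (Tendsto.add h h').congr fun t => ?_
  rw [← smul_add, (W t).map_add]
  congr 1
  abel

theorem HasGenerator.smul {W : ℝ≥0 → H →L[ℂ] H} {x y : H} (c : ℂ)
    (h : HasGenerator W x y) : HasGenerator W (c • x) (c • y) := by
  refine (Tendsto.const_smul h c).congr fun t => ?_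
  rw [smul_comm, (W t).map_smul, smul_sub]

theorem HasGenerator.zero (W : ℝ≥0 → H →L[ℂ] H) : HasGenerator W 0 0 := by
  simp [HasGenerator]

/-- The infinitesimal generator `A` of the semigroup, with its natural domain: those `x` for
which the limit of `(W t x - x) / t` as `t → 0+` exists, and then `A x` is this limit. -/
def generator (W : ℝ≥0 → H →L[ℂ] H) : H →ₗ.[ℂ] H where
  domain :=
    { carrier := {x | ∃ y, HasGenerator W x y}
      add_mem' := by
        rintro a b ⟨y, hy⟩ ⟨z, hz⟩
        exact ⟨y + z, hy.add hz⟩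
      zero_mem' := ⟨0, HasGenerator.zero W⟩
      smul_mem' := by
        rintro c a ⟨y, hy⟩
        exact ⟨c • y, hy.smul c⟩ }
  toFun :=
    { toFun := fun x => Classical.choose x.2
      map_add' := fun a b => (Classical.choose_spec (a + b).2).unique
        ((Classical.choose_spec a.2).add (Classical.choose_spec b.2))
      map_smul' := fun c a => (Classical.choose_spec (c • a).2).unique
        ((Classical.choose_spec a.2).smul c) }

/-- `C` is the cogenerator `(A + I)(A - I)⁻¹` of the semigroup with generator `A`: the graph of the
everywhere defined operator `C` is the set of all pairs `(A x - x, A x + x)`, `x` in the domain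
of `A`. -/
def IsCogenerator (W : ℝ≥0 → H →L[ℂ] H) (C : H →L[ℂ] H) : Prop :=
  ∀ y z : H, C y = z ↔
    ∃ x : (generator W).domain, generator W x - x = y ∧ generator W x + x = z

/-- The class `C_{·1}`: for no non-zero `h` does `(W t)* h` tend to `0` as `t → ∞`. -/
def IsClassCDotOne [CompleteSpace H] (W : ℝ≥0 → H →L[ℂ] H) : Prop :=
  ∀ h : H, h ≠ 0 → ¬ Tendsto (fun t => (W t).adjoint h) atTop (𝓝 0)

/-- The unitary operator `U` seen as a bounded operator. -/
abbrev toCLM (U : H ≃ₗᵢ[ℂ] H) : H →L[ℂ] H :=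
  U.toLinearIsometry.toContinuousLinearMap

/-- The unitary group `U` on the Hilbert space `H'` is a unitary quasi-affine transform of the
semigroup `W` on `H`. -/
def IsUnitaryQuasiAffineTransform {H' : Type*} [NormedAddCommGroup H'] [InnerProductSpace ℂ H']
    [CompleteSpace H'] (U : ℝ → H' ≃ₗᵢ[ℂ] H') (W : ℝ≥0 → H →L[ℂ] H) : Prop :=
  IsUnitaryGroup U ∧ ∃ Λ : H' →L[ℂ] H, IsQuasiAffinity Λ ∧
    ∀ t : ℝ≥0, Λ ∈ intertwiningSet (toCLM (U t)) (W t)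

end Semigroups

section Dilations

variable {H : Type*} [NormedAddCommGroup H] [InnerProductSpace ℂ H]
variable {K : Type*} [NormedAddCommGroup K] [InnerProductSpace ℂ K]

/-- The unitary group `U` on `K`, with `H` embedded in `K` through the isometry `J`, is a minimal
unitary dilation of the semigroup `W` on `H`: the compression of `U t` to `H` is `W t` for all
`t ≥ 0`, and `K` is the closed span of all `U t H`, `t ∈ ℝ`. -/
structure IsMinimalUnitaryDilation (W : ℝ≥0 → H →L[ℂ] H) (U : ℝ → K ≃ₗᵢ[ℂ] K)
    (J : H →ₗᵢ[ℂ] K) : Prop where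
  isUnitaryGroup : IsUnitaryGroup U
  dilation : ∀ (t : ℝ≥0) (h h' : H), inner ℂ (J h') (U t (J h)) = inner ℂ h' (W t h)
  minimal : (Submodule.span ℂ {k : K | ∃ (t : ℝ) (h : H), k = U t (J h)}).topologicalClosure = ⊤

/-- The space `K₊` of the minimal isometric dilation: the closed span of all `U t H`, `t ≥ 0`.
The minimal isometric dilation itself is the restriction of `U t`, `t ≥ 0`, to this space. -/
def isometricSpace (U : ℝ → K ≃ₗᵢ[ℂ] K) (J : H →ₗᵢ[ℂ] K) : Submodule ℂ K :=
  (Submodule.span ℂ {k : K | ∃ (t : ℝ≥0) (h : H), k = U t (J h)}).topologicalClosure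

/-- The space of the unitary part in the Wold decomposition of the minimal isometric dilation:
the intersection of all `U t K₊`, `t ≥ 0`. -/
def residualSpace (U : ℝ → K ≃ₗᵢ[ℂ] K) (J : H →ₗᵢ[ℂ] K) : Submodule ℂ K :=
  ⨅ t : ℝ≥0, (isometricSpace U J).map (U t).toLinearEquiv.toLinearMap

theorem mem_residualSpace {U : ℝ → K ≃ₗᵢ[ℂ] K} {J : H →ₗᵢ[ℂ] K} {k : K} :
    k ∈ residualSpace U J ↔ ∀ t : ℝ≥0, (U t).symm k ∈ isometricSpace U J := by
  simp only [residualSpace, Submodule.mem_iInf]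
  refine forall_congr' fun t => ⟨?_, fun h => ⟨_, h, by simp⟩⟩
  rintro ⟨x, hx, rfl⟩
  simpa using hx

theorem isClosed_residualSpace (U : ℝ → K ≃ₗᵢ[ℂ] K) (J : H →ₗᵢ[ℂ] K) :
    IsClosed (residualSpace U J : Set K) := by
  have : (residualSpace U J : Set K) =
      ⋂ t : ℝ≥0, (U t).symm ⁻¹' (isometricSpace U J : Set K) := by
    ext k
    simp [mem_residualSpace]
  rw [this]
  exact isClosed_iInter fun t =>
    (Submodule.isClosed_topologicalClosure _).preimage (U t).symm.continuous

instance [CompleteSpace K] (U : ℝ → K ≃ₗᵢ[ℂ] K) (J : H →ₗᵢ[ℂ] K) :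
    CompleteSpace (residualSpace U J) :=
  (isClosed_residualSpace U J).completeSpace_coe

theorem IsUnitaryGroup.symm_apply {U : ℝ → K ≃ₗᵢ[ℂ] K} (hU : IsUnitaryGroup U) (t : ℝ) (k : K) :
    (U t).symm k = U (-t) k := by
  rw [LinearIsometryEquiv.symm_apply_eq, ← hU.map_add, add_neg_cancel, hU.map_zero]

theorem map_isometricSpace {U : ℝ → K ≃ₗᵢ[ℂ] K} (hU : IsUnitaryGroup U) {J : H →ₗᵢ[ℂ] K}
    (t : ℝ≥0) {k : K} (hk : k ∈ isometricSpace U J) : U t k ∈ isometricSpace U J := by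
  have hmaps : Set.MapsTo (U t)
      (Submodule.span ℂ {k : K | ∃ (t : ℝ≥0) (h : H), k = U t (J h)} : Set K)
      (Submodule.span ℂ {k : K | ∃ (t : ℝ≥0) (h : H), k = U t (J h)} : Set K) := by
    intro x hx
    have hle : Submodule.span ℂ {k : K | ∃ (t : ℝ≥0) (h : H), k = U t (J h)} ≤
        (Submodule.span ℂ {k : K | ∃ (t : ℝ≥0) (h : H), k = U t (J h)}).comap
          (U t).toLinearEquiv.toLinearMap := by
      rw [Submodule.span_le]
      rintro _ ⟨s, h, rfl⟩
      refine Submodule.subset_span ⟨t + s, h, ?_⟩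
      rw [NNReal.coe_add, hU.map_add]
      rfl
    exact hle hx
  exact hmaps.closure (U t).continuous hk

theorem map_residualSpace {U : ℝ → K ≃ₗᵢ[ℂ] K} (hU : IsUnitaryGroup U) {J : H →ₗᵢ[ℂ] K}
    (s : ℝ) {k : K} (hk : k ∈ residualSpace U J) : U s k ∈ residualSpace U J := by
  rw [mem_residualSpace] at hk ⊢
  intro t
  have h1 := map_isometricSpace hU s.toNNReal (hk (t + (-s).toNNReal))
  rw [hU.symm_apply, ← hU.map_add] at h1
  rw [hU.symm_apply, ← hU.map_add]
  convert h1 using 3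
  simp only [NNReal.coe_add, Real.coe_toNNReal']
  rcases le_total 0 s with h | h
  · rw [max_eq_left h, max_eq_right (by linarith)]
    ring
  · rw [max_eq_right h, max_eq_left (by linarith)]
    ring

/-- The residual group: the restriction `R t` of `U t` to the residual space, `t ∈ ℝ`. -/
def residualGroup {U : ℝ → K ≃ₗᵢ[ℂ] K} (hU : IsUnitaryGroup U) (J : H →ₗᵢ[ℂ] K) (t : ℝ) :
    residualSpace U J ≃ₗᵢ[ℂ] residualSpace U J where
  toFun k := ⟨U t k, map_residualSpace hU t k.2⟩
  invFun k := ⟨U (-t) k, map_residualSpace hU (-t) k.2⟩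
  map_add' a b := by
    ext
    simp
  map_smul' c a := by
    ext
    simp
  left_inv k := by
    ext
    simp [← hU.symm_apply]
  right_inv k := by
    ext
    simp [← hU.symm_apply]
  norm_map' k := (U t).norm_map k

/-- The operator `Λ₀ = P_H | R` from the residual space to `H`. Since `H` is embedded through the
isometry `J`, the orthogonal projection onto `H` is the adjoint of `J`. -/
def residualProjection [CompleteSpace H] [CompleteSpace K] (U : ℝ → K ≃ₗᵢ[ℂ] K)
    (J : H →ₗᵢ[ℂ] K) : residualSpace U J →L[ℂ] H :=
  J.toContinuousLinearMap.adjoint ∘L (residualSpace U J).subtypeL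

end Dilations

end QuasiAffine

end

namespace QuasiAffine

open MeasureTheory Set

/-! ### Unitary groups: Laplace transforms and invariant subspaces. -/

section UnitaryGroup

variable {E : Type*} [NormedAddCommGroup E] [InnerProductSpace ℂ E]
variable {V : ℝ → E ≃ₗᵢ[ℂ] E}

/-! If `Λ` intertwines a unitary group with `W`, then `‖Λ* W_t* h‖ = ‖Λ* h‖` for all `t`; so `W_t* h
→ 0` forces `Λ* h = 0`, and dense range gives `h = 0`.

Conversely, in a minimal unitary dilation `U_t W_t* h` is the projection of `h` onto `U_t K₊`. These
spaces decrease, so the projections converge to a vector of `R`. If `h ⊥ R` the limit is `0` and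
`W_t* h → 0` (`tendsto_adjoint`). Hence class `C_{·1}` makes the range of `Λ₀` dense.

Injectivity uses `Ker C = 0`. The kernel `N` of `Λ₀` is invariant under `R_t`, `t ≥ 0`. With `B` the
generator of `R`, put `G = ∫₀^∞ e^{-s} R_{-s} ds = (I + B)⁻¹`. For `k ∈ N` the vector `x = Λ₀ G k`
satisfies `A x = -x`, so `C(-2x) = 0` and `x = 0`. Thus `G N ⊆ N`, which makes `N` invariant under
all `R_t`, `t ∈ ℝ` (`apply_mem_of_laplaceAtOne_mem`). So `P_H U_t k = 0` for every real `t`, and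
minimality gives `k = 0`.

A minimal dilation exists because the kernel `W (y - x)`, with `W (-t) = W_t*`, is positive
semidefinite (`kernelForm_nonneg`); translation acts unitarily on its reproducing kernel space. -/

theorem IsUnitaryGroup.inner_apply_left (hV : IsUnitaryGroup V) (t : ℝ) (x y : E) :
    inner ℂ (V t x) y = inner ℂ x (V (-t) y) := by
  rw [← (V (-t)).inner_map_map, ← hV.map_add, neg_add_cancel, hV.map_zero]

theorem IsUnitaryGroup.comp_neg (hV : IsUnitaryGroup V) : IsUnitaryGroup fun t => V (-t) where
  map_zero h := by rw [neg_zero, hV.map_zero]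
  map_add t s h := by rw [neg_add, hV.map_add]
  continuous h := (hV.continuous h).comp continuous_neg

/-- The Laplace transform at `1` of the orbit of `k` under the group `V`. -/
noncomputable def laplaceAtOne (V : ℝ → E ≃ₗᵢ[ℂ] E) (k : E) : E :=
  ∫ s in Ioi (0 : ℝ), Real.exp (-s) • V s k

theorem IsUnitaryGroup.continuous_exp_smul (hV : IsUnitaryGroup V) (k : E) :
    Continuous fun s : ℝ => Real.exp (-s) • V s k :=
  (Real.continuous_exp.comp continuous_neg).smul (hV.continuous k)

theorem IsUnitaryGroup.integrableOn_exp_smul (hV : IsUnitaryGroup V) (k : E) (a : ℝ) :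
    IntegrableOn (fun s : ℝ => Real.exp (-s) • V s k) (Ioi a) := by
  refine ((integrableOn_exp_neg_Ioi a).mul_const ‖k‖).mono'
    (hV.continuous_exp_smul k).aestronglyMeasurable (Eventually.of_forall fun s => ?_)
  rw [norm_smul, (V s).norm_map, Real.norm_of_nonneg (Real.exp_pos _).le]

theorem IsUnitaryGroup.laplaceAtOne_add (hV : IsUnitaryGroup V) (a b : E) :
    laplaceAtOne V (a + b) = laplaceAtOne V a + laplaceAtOne V b := by
  simp only [laplaceAtOne, _root_.map_add, smul_add]
  exact integral_add (hV.integrableOn_exp_smul a 0) (hV.integrableOn_exp_smul b 0)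

variable [CompleteSpace E]

theorem IsUnitaryGroup.apply_laplaceAtOne (hV : IsUnitaryGroup V) (t : ℝ) (k : E) :
    V t (laplaceAtOne V k) = laplaceAtOne V (V t k) := by
  refine ((V t).toLinearIsometry.integral_comp_comm _).symm.trans ?_
  refine integral_congr_ae (Eventually.of_forall fun s => ?_)
  change V t (Real.exp (-s) • V s k) = Real.exp (-s) • V s (V t k)
  rw [map_real_smul (V t) (V t).continuous, ← hV.map_add, ← hV.map_add, add_comm t s]

/-- Shifting the integration variable leaves `t` only in a scalar factor and an endpoint, so the
right side can be differentiated in `t` even when the orbit of `k` cannot. -/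
theorem IsUnitaryGroup.apply_laplaceAtOne_eq (hV : IsUnitaryGroup V) (t : ℝ) (k : E) :
    V t (laplaceAtOne V k) =
      Real.exp t • (laplaceAtOne V k - ∫ s in (0 : ℝ)..t, Real.exp (-s) • V s k) := by
  have h1 : V t (laplaceAtOne V k) = Real.exp t • ∫ s in Ioi t, Real.exp (-s) • V s k := by
    have h2 := (measurePreserving_add_right volume t).setIntegral_preimage_emb
      (MeasurableEquiv.addRight t).measurableEmbedding
      (fun s => Real.exp t • Real.exp (-s) • V s k) (Ioi t)
    rw [preimage_add_const_Ioi, sub_self] at h2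
    rw [hV.apply_laplaceAtOne, laplaceAtOne, ← integral_smul, ← h2]
    refine integral_congr_ae (Eventually.of_forall fun s => ?_)
    simp only [hV.map_add, smul_smul, ← Real.exp_add]
    congr 2
    ring
  rw [h1, laplaceAtOne, ← intervalIntegral.integral_Ioi_sub_Ioi'
    (hV.integrableOn_exp_smul k 0) (hV.integrableOn_exp_smul k t), sub_sub_cancel]

/-- Orbits of Laplace transforms are differentiable. -/
theorem IsUnitaryGroup.hasDerivAt_laplaceAtOne (hV : IsUnitaryGroup V) (t : ℝ) (k : E) :
    HasDerivAt (fun t => V t (laplaceAtOne V k)) (V t (laplaceAtOne V k - k)) t := by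
  have h1 := ((hV.continuous_exp_smul k).integral_hasStrictDerivAt 0 t).hasDerivAt
  have h2 := (Real.hasDerivAt_exp t).smul (h1.const_sub (laplaceAtOne V k))
  refine (h2.congr_deriv ?_).congr_of_eventuallyEq
    (Eventually.of_forall fun s => hV.apply_laplaceAtOne_eq s k)
  rw [map_sub, hV.apply_laplaceAtOne_eq, smul_neg, smul_smul, ← Real.exp_add, add_neg_cancel,
    Real.exp_zero, one_smul]
  abel

/-- Skew-adjointness of the generator on the range of the Laplace transform: the derivative at `0`
of a constant inner product. -/
theorem IsUnitaryGroup.laplaceAtOne_inner_add (hV : IsUnitaryGroup V) (a b : E) :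
    inner ℂ (laplaceAtOne V a) (laplaceAtOne V b - b) +
      inner ℂ (laplaceAtOne V a - a) (laplaceAtOne V b) = 0 := by
  have h := (hV.hasDerivAt_laplaceAtOne 0 a).inner ℂ (hV.hasDerivAt_laplaceAtOne 0 b)
  simp only [(V _).inner_map_map] at h
  exact h.unique (hasDerivAt_const _ _)

/-- Orbits of Laplace transforms are total. -/
theorem IsUnitaryGroup.eq_zero_of_inner_laplaceAtOne (hV : IsUnitaryGroup V) {w : E}
    (h : ∀ t z, inner ℂ w (V t (laplaceAtOne V z)) = 0) : w = 0 := by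
  have h1 := (hasDerivAt_const (0 : ℝ) w).inner ℂ (hV.hasDerivAt_laplaceAtOne 0 w)
  simp only [h, hV.map_zero, inner_zero_left, add_zero, inner_sub_right] at h1
  have h2 := h1.unique (hasDerivAt_const _ _)
  have h3 := h 0 w
  rw [hV.map_zero] at h3
  rw [h3, zero_sub, neg_eq_zero] at h2
  exact inner_self_eq_zero.1 h2

/-- `V s` is the adjoint of `V (-s)`, so it preserves `Nᗮ` for `s ≥ 0`; integrate. -/
theorem laplaceAtOne_mem_orthogonal (hV : IsUnitaryGroup V) {N : Submodule ℂ E}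
    (hN : ∀ t : ℝ, 0 ≤ t → ∀ k ∈ N, V (-t) k ∈ N) {z : E} (hz : z ∈ Nᗮ) :
    laplaceAtOne V z ∈ Nᗮ := by
  rw [Submodule.mem_orthogonal]
  intro n hn
  rw [laplaceAtOne, ← integral_inner (hV.integrableOn_exp_smul z 0)]
  refine setIntegral_eq_zero_of_forall_eq_zero fun s hs => ?_
  refine (Submodule.mem_orthogonal _ _).1 (Submodule.smul_of_tower_mem _ _ ?_) n hn
  rw [Submodule.mem_orthogonal]
  intro m hm
  have := hV.inner_apply_left (-s) m z
  rw [neg_neg] at this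
  rw [← this]
  exact (Submodule.mem_orthogonal _ _).1 hz _ (hN s (le_of_lt hs) m hm)

/-- A closed subspace which is invariant under the backward part of a unitary group and under
the Laplace transform at `1` of the forward part is invariant under the group. -/
theorem IsUnitaryGroup.apply_mem_of_laplaceAtOne_mem (hV : IsUnitaryGroup V) (N : Submodule ℂ E)
    [N.HasOrthogonalProjection] (hN : ∀ t : ℝ, 0 ≤ t → ∀ k ∈ N, V (-t) k ∈ N)
    (hG : ∀ k ∈ N, laplaceAtOne V k ∈ N) (t : ℝ) {k : E} (hk : k ∈ N) : V t k ∈ N := by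
  set Q : E →L[ℂ] E := Nᗮ.starProjection with hQ
  have hQ0 : ∀ x, Q x = 0 ↔ x ∈ N := fun x => by
    rw [hQ, Submodule.starProjection_apply_eq_zero_iff, Submodule.orthogonal_orthogonal]
  -- Both `N` and `Nᗮ` are invariant under the Laplace transform, so the projection commutes with
  -- it.
  have hQG : ∀ x, Q (laplaceAtOne V x) = laplaceAtOne V (Q x) := fun x => by
    obtain ⟨a, ha, b, hb, rfl⟩ := N.exists_add_mem_mem_orthogonal x
    rw [hV.laplaceAtOne_add, _root_.map_add, _root_.map_add, (hQ0 _).2 ha, (hQ0 _).2 (hG a ha), zero_add,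
      zero_add, Submodule.starProjection_eq_self_iff.2 hb,
      Submodule.starProjection_eq_self_iff.2 (laplaceAtOne_mem_orthogonal hV hN hb)]
  have hconst : ∀ a b s, inner ℂ (Q (V s (laplaceAtOne V a))) (V s (laplaceAtOne V b)) =
      inner ℂ (Q (laplaceAtOne V a)) (laplaceAtOne V b) := by
    intro a b s
    have hd : ∀ s, HasDerivAt (fun s => inner ℂ (Q (V s (laplaceAtOne V a)))
        (V s (laplaceAtOne V b))) 0 s := by
      intro s
      have h1 : HasDerivAt (fun s => Q (V s (laplaceAtOne V a)))
          (Q (V s (laplaceAtOne V a - a))) s :=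
        (Q.restrictScalars ℝ).hasFDerivAt.comp_hasDerivAt s (hV.hasDerivAt_laplaceAtOne s a)
      -- Since `Q` commutes with the Laplace transform, this is the skew-adjointness identity for `Q
      -- (V s a)` and `V s b`.
      refine (h1.inner ℂ (hV.hasDerivAt_laplaceAtOne s b)).congr_deriv ?_
      rw [map_sub, map_sub, hV.apply_laplaceAtOne, hV.apply_laplaceAtOne, map_sub, hQG]
      exact hV.laplaceAtOne_inner_add _ _
    have := is_const_of_deriv_eq_zero (fun s => (hd s).differentiableAt) (fun s => (hd s).deriv) s 0
    simpa only [hV.map_zero] using this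
  have hzero : ∀ s, Q (V s (laplaceAtOne V k)) = 0 := fun s => by
    refine hV.eq_zero_of_inner_laplaceAtOne fun r z => ?_
    -- The second vector is chosen so that `V s` carries its Laplace transform to `V r (laplaceAtOne
    -- V z)`.
    have h1 := hconst k (V (r - s) z) s
    rw [← hV.apply_laplaceAtOne (r - s), ← hV.map_add, add_sub_cancel, (hQ0 _).2 (hG k hk),
      inner_zero_left] at h1
    exact h1
  -- Differentiating the zero function removes the Laplace transform and leaves `-Q (V t k) = 0`.
  have h1 : HasDerivAt (fun s => Q (V s (laplaceAtOne V k))) (Q (V t (laplaceAtOne V k - k))) t :=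
    (Q.restrictScalars ℝ).hasFDerivAt.comp_hasDerivAt t (hV.hasDerivAt_laplaceAtOne t k)
  simp only [hzero, map_sub, zero_sub] at h1
  exact (hQ0 _).1 (neg_eq_zero.1 (h1.unique (hasDerivAt_const _ _)))

end UnitaryGroup

end QuasiAffine

namespace QuasiAffine

/-! ### Existence of a minimal unitary dilation. -/

section Existence

variable {H : Type*} [NormedAddCommGroup H] [InnerProductSpace ℂ H] [CompleteSpace H]

/-- The extension of a semigroup to the real line by `W (-t) = (W t)*`. -/
noncomputable def hermitianExtension (W : ℝ≥0 → H →L[ℂ] H) (t : ℝ) : H →L[ℂ] H :=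
  if 0 ≤ t then W t.toNNReal else (W (-t).toNNReal).adjoint

variable {W : ℝ≥0 → H →L[ℂ] H}

theorem hermitianExtension_coe (t : ℝ≥0) : hermitianExtension W t = W t := by
  simp [hermitianExtension]

theorem IsContractionSemigroup.adjoint_hermitianExtension (hW : IsContractionSemigroup W)
    (t : ℝ) : (hermitianExtension W t).adjoint = hermitianExtension W (-t) := by
  rcases lt_trichotomy t 0 with h | rfl | h
  · simp [hermitianExtension, h.not_ge, h.le]
  · simp only [hermitianExtension, neg_zero, le_refl, if_true, Real.toNNReal_zero, hW.map_zero]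
    exact ContinuousLinearMap.adjoint_id
  · simp [hermitianExtension, h.not_ge, h.le]

theorem IsContractionSemigroup.hermitianExtension_add (hW : IsContractionSemigroup W)
    {s t : ℝ} (hs : 0 ≤ s) (ht : 0 ≤ t) (h : H) :
    hermitianExtension W (s + t) h = hermitianExtension W s (hermitianExtension W t h) := by
  simp only [hermitianExtension, hs, ht, add_nonneg, if_true, Real.toNNReal_add hs ht, hW.map_add]
  rfl

theorem IsContractionSemigroup.hermitianExtension_zero (hW : IsContractionSemigroup W) (h : H) :
    hermitianExtension W 0 h = h := by
  simp [hermitianExtension, hW.map_zero]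

theorem IsContractionSemigroup.norm_hermitianExtension_le (hW : IsContractionSemigroup W)
    (t : ℝ) (h : H) : ‖hermitianExtension W t h‖ ≤ ‖h‖ := by
  refine (ContinuousLinearMap.le_of_opNorm_le _ ?_ h).trans_eq (one_mul _)
  unfold hermitianExtension
  split_ifs
  · exact hW.contraction _
  · exact (LinearIsometryEquiv.norm_map _ _).trans_le (hW.contraction _)

theorem IsContractionSemigroup.re_inner_comm (hW : IsContractionSemigroup W) (x y : ℝ) (g h : H) :
    RCLike.re (inner ℂ (hermitianExtension W (x - y) g) h) =
      RCLike.re (inner ℂ (hermitianExtension W (y - x) h) g) := by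
  rw [← neg_sub x y, ← hW.adjoint_hermitianExtension, ContinuousLinearMap.adjoint_inner_left,
    inner_re_symm]

/-- The quadratic form of the kernel attached to a semigroup. -/
noncomputable def kernelForm (W : ℝ≥0 → H →L[ℂ] H) (s : Finset ℝ) (f : ℝ → H) : ℝ :=
  ∑ x ∈ s, ∑ y ∈ s, RCLike.re (inner ℂ (hermitianExtension W (x - y) (f x)) (f y))

theorem IsContractionSemigroup.kernelForm_insert (hW : IsContractionSemigroup W) {s : Finset ℝ}
    {a : ℝ} (ha : a ∉ s) (f : ℝ → H) :
    kernelForm W (insert a s) f = kernelForm W s f +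
      2 * ∑ y ∈ s, RCLike.re (inner ℂ (hermitianExtension W (a - y) (f a)) (f y)) +
      ‖f a‖ ^ 2 := by
  simp only [kernelForm, Finset.sum_insert ha, Finset.sum_add_distrib]
  rw [Finset.sum_congr rfl fun x _ => hW.re_inner_comm x a (f x) (f a), sub_self,
    hW.hermitianExtension_zero, inner_self_eq_norm_sq]
  ring

theorem IsContractionSemigroup.kernelForm_update (hW : IsContractionSemigroup W) {s : Finset ℝ}
    {b : ℝ} (hb : b ∈ s) (f : ℝ → H) (c : H) :
    kernelForm W s (Function.update f b (f b + c)) = kernelForm W s f +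
      2 * ∑ y ∈ s, RCLike.re (inner ℂ (hermitianExtension W (b - y) c) (f y)) + ‖c‖ ^ 2 := by
  obtain ⟨s, hbs, rfl⟩ : ∃ s', b ∉ s' ∧ s = insert b s' :=
    ⟨s.erase b, Finset.notMem_erase _ _, (Finset.insert_erase hb).symm⟩
  have hne : ∀ x ∈ s, Function.update f b (f b + c) x = f x := fun x hx =>
    Function.update_of_ne (ne_of_mem_of_not_mem hx hbs) _ _
  have h1 : kernelForm W s (Function.update f b (f b + c)) = kernelForm W s f :=
    Finset.sum_congr rfl fun x hx => Finset.sum_congr rfl fun y hy => by rw [hne x hx, hne y hy]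
  rw [hW.kernelForm_insert hbs, hW.kernelForm_insert hbs, h1, Finset.sum_insert hbs,
    Finset.sum_congr rfl fun y hy => by rw [hne y hy], Function.update_self, sub_self,
    hW.hermitianExtension_zero, @norm_add_sq ℂ, inner_re_symm c]
  simp only [_root_.map_add, inner_add_left, Finset.sum_add_distrib]
  ring

/-- Induction on the largest point `a`. Moving its mass to the next point `b`, as `W (a - b) (f a)`,
leaves all cross terms unchanged by the semigroup law and does not increase the diagonal term by
contractivity. -/
theorem IsContractionSemigroup.kernelForm_nonneg (hW : IsContractionSemigroup W) (s : Finset ℝ) :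
    ∀ f : ℝ → H, 0 ≤ kernelForm W s f := by
  induction s using Finset.induction_on_max with
  | empty => intro f; simp [kernelForm]
  | insert a s has ih =>
    intro f
    have ha : a ∉ s := fun h => lt_irrefl _ (has a h)
    rw [hW.kernelForm_insert ha]
    rcases s.eq_empty_or_nonempty with rfl | hs
    · simp only [Finset.sum_empty, mul_zero, add_zero]
      exact add_nonneg (ih f) (sq_nonneg _)
    set b := s.max' hs
    have hb : b ∈ s := s.max'_mem hs
    set c := hermitianExtension W (a - b) (f a)
    have h1 := ih (Function.update f b (f b + c))
    rw [hW.kernelForm_update hb] at h1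
    have h2 : ∀ y ∈ s, hermitianExtension W (a - y) (f a) = hermitianExtension W (b - y) c := by
      intro y hy
      rw [← hW.hermitianExtension_add (sub_nonneg.2 (s.le_max' y hy))
        (sub_nonneg.2 (has b hb).le)]
      congr 2
      ring
    rw [Finset.sum_congr rfl fun y hy => by rw [h2 y hy]]
    have h3 : ‖c‖ ^ 2 ≤ ‖f a‖ ^ 2 := by
      gcongr
      exact hW.norm_hermitianExtension_le _ _
    linarith

/-- The kernel on the real line attached to a semigroup. -/
noncomputable def semigroupKernel (W : ℝ≥0 → H →L[ℂ] H) : Matrix ℝ ℝ (H →L[ℂ] H) :=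
  .of fun x y => hermitianExtension W (y - x)

theorem IsContractionSemigroup.posSemidef_semigroupKernel (hW : IsContractionSemigroup W) :
    (semigroupKernel W).PosSemidef := by
  have h := (RKHS.posSemidef_tfae (K := semigroupKernel W)).out 2 0
  refine h.1 ⟨?_, fun f => ?_⟩
  · ext x y : 2
    simp only [semigroupKernel, Matrix.conjTranspose_apply, Matrix.of_apply,
      ContinuousLinearMap.star_eq_adjoint, hW.adjoint_hermitianExtension, neg_sub]
  · have := hW.kernelForm_nonneg f.support f
    simpa only [kernelForm, Finsupp.sum, map_sum, semigroupKernel, Matrix.of_apply] using this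

/-- A permutation of a total family which preserves the Gram matrix is induced by a unitary
operator. -/
theorem exists_linearIsometryEquiv_of_inner_eq {ι K : Type*} [NormedAddCommGroup K]
    [InnerProductSpace ℂ K] [CompleteSpace K] (φ : ι → K)
    (hφ : (Submodule.span ℂ (Set.range φ)).topologicalClosure = ⊤) (e : ι ≃ ι)
    (he : ∀ i j, inner ℂ (φ (e i)) (φ (e j)) = inner ℂ (φ i) (φ j)) :
    ∃ U : K ≃ₗᵢ[ℂ] K, ∀ i, U (φ i) = φ (e i) := by
  set L : (ι →₀ ℂ) →ₗ[ℂ] K := Finsupp.linearCombination ℂ φ with hL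
  have hd : DenseRange L := by
    rw [← Finsupp.range_linearCombination, ← Submodule.dense_iff_topologicalClosure_eq_top] at hφ
    exact hφ
  obtain ⟨F, hF⟩ : ∃ F : (ι →₀ ℂ) ≃ₗ[ℂ] (ι →₀ ℂ), ∀ x, F x = Finsupp.equivMapDomain e x :=
    ⟨Finsupp.domLCongr e, fun _ => rfl⟩
  -- The norm of a finite combination depends only on its coefficients and the Gram matrix, which
  -- `e` preserves.
  have hn : ∀ x, ‖L (F x)‖ = ‖L x‖ := by
    intro x
    have h : ∀ ψ : ι → K, ‖Finsupp.linearCombination ℂ ψ x‖ ^ 2 = RCLike.re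
        (x.sum fun i a => x.sum fun j b => b * (starRingEnd ℂ a * inner ℂ (ψ i) (ψ j))) := by
      intro ψ
      rw [← inner_self_eq_norm_sq (𝕜 := ℂ), Finsupp.linearCombination_apply, Finsupp.sum_inner]
      simp only [Finsupp.inner_sum, inner_smul_left, inner_smul_right]
    have h1 : L (F x) = Finsupp.linearCombination ℂ (φ ∘ e) x := by
      rw [hF, hL, Finsupp.linearCombination_equivMapDomain]
    rw [← sq_eq_sq₀ (norm_nonneg _) (norm_nonneg _), h1, h, hL, h]
    simp only [Function.comp_apply, he]
  refine ⟨F.extendOfIsometry L L hd hd hn, fun i => ?_⟩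
  have h := F.extendOfIsometry_eq L L hd hd hn (Finsupp.single i 1)
  rw [hF, Finsupp.equivMapDomain_single] at h
  simpa only [hL, Finsupp.linearCombination_single, one_smul] using h

/-- A map into a Hilbert space whose Gram matrix is given by a contraction semigroup is
continuous. -/
theorem IsContractionSemigroup.continuous_of_inner_eq_hermitianExtension
    (hW : IsContractionSemigroup W) {K : Type*} [NormedAddCommGroup K] [InnerProductSpace ℂ K]
    (v : H) {f : ℝ → K}
    (hf : ∀ s t, inner ℂ (f s) (f t) = inner ℂ (hermitianExtension W (s - t) v) v) :
    Continuous f := by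
  -- Taking adjoints does not change the real part, so continuity of `W` on `t ≥ 0` suffices.
  have hre : ∀ t, RCLike.re (inner ℂ (hermitianExtension W t v) v) =
      RCLike.re (inner ℂ (W |t|.toNNReal v) v) := by
    intro t
    rcases le_total 0 t with h | h
    · simp [hermitianExtension, h, abs_of_nonneg]
    · have := hW.re_inner_comm t 0 v v
      rw [sub_zero, zero_sub] at this
      rw [this, abs_of_nonpos h]
      simp [hermitianExtension, h]
  have hnorm : ∀ s t, ‖f t - f s‖ ^ 2 =
      2 * (‖v‖ ^ 2 - RCLike.re (inner ℂ (W |t - s|.toNNReal v) v)) := by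
    intro s t
    have h1 : ∀ s, ‖f s‖ ^ 2 = ‖v‖ ^ 2 := fun s => by
      rw [← inner_self_eq_norm_sq (𝕜 := ℂ), hf, sub_self, hW.hermitianExtension_zero,
        inner_self_eq_norm_sq]
    rw [@norm_sub_sq ℂ, h1, h1, hf, hre]
    ring
  refine continuous_iff_continuousAt.2 fun s => tendsto_iff_norm_sub_tendsto_zero.2 ?_
  have h2 : Continuous fun t => √(2 * (‖v‖ ^ 2 -
      RCLike.re (inner ℂ (W |t - s|.toNNReal v) v))) := by
    have h3 : Continuous fun t : ℝ => W |t - s|.toNNReal v :=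
      (hW.continuous v).comp (by fun_prop)
    exact Real.continuous_sqrt.comp (continuous_const.mul (continuous_const.sub
      (RCLike.continuous_re.comp (h3.inner continuous_const))))
  have h4 := h2.tendsto s
  rw [sub_self, abs_zero, Real.toNNReal_zero, hW.map_zero, ContinuousLinearMap.id_apply,
    inner_self_eq_norm_sq, sub_self, mul_zero, Real.sqrt_zero] at h4
  refine h4.congr fun t => ?_
  rw [← hnorm, Real.sqrt_sq (norm_nonneg _)]

/-- Unitary operators which translate a total family form a strongly continuous group, if they
do so on the family. -/
theorem isUnitaryGroup_of_translation {X K : Type*} [NormedAddCommGroup K]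
    [InnerProductSpace ℂ K] (φ : ℝ × X → K)
    (hφ : (Submodule.span ℂ (Set.range φ)).topologicalClosure = ⊤) (U : ℝ → K ≃ₗᵢ[ℂ] K)
    (hU : ∀ t p, U t (φ p) = φ (p.1 + t, p.2)) (hc : ∀ x v, Continuous fun t => φ (x + t, v)) :
    IsUnitaryGroup U := by
  have hd := Submodule.dense_iff_topologicalClosure_eq_top.2 hφ
  have hext : ∀ f g : K →L[ℂ] K, (∀ p, f (φ p) = g (φ p)) → ∀ k, f k = g k := by
    intro f g h k
    rw [ContinuousLinearMap.ext_on hd (f := f) (g := g)]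
    rintro _ ⟨p, rfl⟩
    exact h p
  refine ⟨hext (toCLM (U 0)) (ContinuousLinearMap.id ℂ K) ?_,
    fun t s => hext (toCLM (U (t + s))) (toCLM (U t) ∘L toCLM (U s)) ?_, fun k => ?_⟩
  · intro p
    exact (hU 0 p).trans (by simp)
  · intro p
    refine (hU _ p).trans ?_
    simp [hU, add_comm t s, add_assoc]
  · let S : Submodule ℂ K :=
      { carrier := {k | Continuous fun t => U t k}
        add_mem' := fun {a b} ha hb => by
          simpa only [Set.mem_ofPred_eq, _root_.map_add] using Continuous.fun_add ha hb
        zero_mem' := by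
          simpa only [Set.mem_ofPred_eq, _root_.map_zero] using continuous_const
        smul_mem' := fun c a ha => by
          simpa only [Set.mem_ofPred_eq, _root_.map_smul] using Continuous.fun_const_smul ha c }
    have hS : Submodule.span ℂ (Set.range φ) ≤ S := by
      rw [Submodule.span_le]
      rintro _ ⟨p, rfl⟩
      change Continuous fun t => U t (φ p)
      simp only [hU]
      exact hc _ _
    -- The `U t` are isometries, so approximating `k` from the span approximates its orbit uniformly
    -- in `t`.
    refine continuous_of_uniform_approx_of_continuous fun u hu => ?_
    obtain ⟨ε, hε, hεu⟩ := Metric.mem_uniformity_dist.1 hu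
    obtain ⟨y, hy, hdist⟩ := Metric.dense_iff.1 hd k ε hε
    refine ⟨fun t => U t y, hS hdist, fun t => hεu ?_⟩
    rw [(U t).dist_map, dist_comm]
    exact hy

/-- Every strongly continuous contraction semigroup has a minimal unitary dilation. -/
theorem IsContractionSemigroup.exists_isMinimalUnitaryDilation
    {H : Type u} [NormedAddCommGroup H] [InnerProductSpace ℂ H] [CompleteSpace H]
    {W : ℝ≥0 → H →L[ℂ] H} (hW : IsContractionSemigroup W) :
    ∃ (K : Type u) (_ : NormedAddCommGroup K) (_ : InnerProductSpace ℂ K)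
      (_ : CompleteSpace K) (U : ℝ → K ≃ₗᵢ[ℂ] K) (J : H →ₗᵢ[ℂ] K),
      IsMinimalUnitaryDilation W U J := by
  have : Fact (semigroupKernel W).PosSemidef := ⟨hW.posSemidef_semigroupKernel⟩
  let K := RKHS.OfKernel (semigroupKernel W)
  let φ : ℝ × H → K := fun p => RKHS.kerFun K p.1 p.2
  have hinner : ∀ p q, inner ℂ (φ p) (φ q) =
      inner ℂ (hermitianExtension W (p.1 - q.1) p.2) q.2 := fun p q => by
    rw [← RKHS.kernel_inner, RKHS.OfKernel.kernel_ofKernel]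
    rfl
  have hφ : (Submodule.span ℂ (Set.range φ)).topologicalClosure = ⊤ := by
    rw [← RKHS.kerFun_dense K]
    congr 2
    ext k
    simp [φ]
  -- The Gram matrix depends on the first coordinates only through their difference.
  have hU : ∀ t : ℝ, ∃ U : K ≃ₗᵢ[ℂ] K, ∀ p, U (φ p) = φ (p.1 + t, p.2) := fun t =>
    exists_linearIsometryEquiv_of_inner_eq φ hφ ((Equiv.addRight t).prodCongr (Equiv.refl H))
      fun p q => by simp [hinner]
  choose U hU using hU
  have hcont : ∀ v, Continuous fun t => φ (t, v) := fun v =>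
    hW.continuous_of_inner_eq_hermitianExtension v fun s t => hinner (s, v) (t, v)
  have hUG : IsUnitaryGroup U := isUnitaryGroup_of_translation φ hφ U hU fun x v =>
    (hcont v).comp (continuous_const.add continuous_id)
  let J : H →ₗᵢ[ℂ] K := (RKHS.kerFun K (0 : ℝ)).toLinearMap.isometryOfInner fun g h => by
    refine (hinner (0, g) (0, h)).trans ?_
    simp only [sub_self, hW.hermitianExtension_zero]
  have hUJ : ∀ t h, U t (J h) = φ (t, h) := fun t h => by
    refine (hU t (0, h)).trans ?_
    rw [zero_add]
  refine ⟨K, inferInstance, inferInstance, inferInstance, U, J, hUG, fun t h h' => ?_, ?_⟩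
  · have h0 : J h' = φ (0, h') := rfl
    rw [hUJ, h0, hinner, ← ContinuousLinearMap.adjoint_inner_right,
      hW.adjoint_hermitianExtension]
    simp [hermitianExtension_coe]
  · rw [← hφ]
    congr 2
    ext k
    simp [hUJ, eq_comm]

end Existence

end QuasiAffine

namespace QuasiAffine

/-! ### The residual space and its projection onto `H`. -/

section Residual

variable {H : Type*} [NormedAddCommGroup H] [InnerProductSpace ℂ H]
variable {K : Type*} [NormedAddCommGroup K] [InnerProductSpace ℂ K]
variable {W : ℝ≥0 → H →L[ℂ] H} {U : ℝ → K ≃ₗᵢ[ℂ] K} {J : H →ₗᵢ[ℂ] K}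

theorem generator_apply_of_hasGenerator {x y : H} (h : HasGenerator W x y) :
    generator W ⟨x, y, h⟩ = y :=
  (Classical.choose_spec (⟨y, h⟩ : ∃ y, HasGenerator W x y)).unique h

/-- If the cogenerator is injective, then `-1` is not an eigenvalue of the generator. -/
theorem IsCogenerator.eq_zero_of_hasGenerator_neg {C : H →L[ℂ] H} (hC : IsCogenerator W C)
    (hker : LinearMap.ker C.toLinearMap = ⊥) {x : H} (hx : HasGenerator W x (-x)) : x = 0 := by
  -- For `A x = -x` the pair `(A x - x, A x + x)` is `(-2x, 0)`.
  have h1 : C (-x - x) = 0 := by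
    refine (hC _ _).2 ⟨⟨x, _, hx⟩, ?_, ?_⟩
    · rw [generator_apply_of_hasGenerator hx]
    · rw [generator_apply_of_hasGenerator hx, neg_add_cancel]
  have h2 : -x - x = 0 := LinearMap.ker_eq_bot'.1 hker _ h1
  have h3 : (2 : ℂ) • x = 0 := by
    rw [two_smul, ← neg_eq_zero, neg_add', h2]
  exact (smul_eq_zero.1 h3).resolve_left two_ne_zero

theorem isUnitaryGroup_residualGroup (hU : IsUnitaryGroup U) (J : H →ₗᵢ[ℂ] K) :
    IsUnitaryGroup (residualGroup hU J) where
  map_zero k := Subtype.ext (hU.map_zero k)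
  map_add t s k := Subtype.ext (hU.map_add t s k)
  continuous k := (hU.continuous k).subtype_mk _

theorem isometricSpace_apply_mem (U : ℝ → K ≃ₗᵢ[ℂ] K) (J : H →ₗᵢ[ℂ] K) (t : ℝ≥0) (h : H) :
    U t (J h) ∈ isometricSpace U J :=
  Submodule.le_topologicalClosure _ (Submodule.subset_span ⟨t, h, rfl⟩)

theorem residualSpace_le_isometricSpace (hU : IsUnitaryGroup U) :
    residualSpace U J ≤ isometricSpace U J := fun k hk => by
  have := mem_residualSpace.1 hk 0
  rwa [NNReal.coe_zero, hU.symm_apply, neg_zero, hU.map_zero] at this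

theorem IsMinimalUnitaryDilation.symm_apply_mem (hU : IsMinimalUnitaryDilation W U J)
    {s t : ℝ≥0} (hst : t ≤ s) (h : H) : (U t).symm (U s (J h)) ∈ isometricSpace U J := by
  rw [hU.isUnitaryGroup.symm_apply, ← hU.isUnitaryGroup.map_add, neg_add_eq_sub,
    ← NNReal.coe_sub hst]
  exact isometricSpace_apply_mem _ _ _ _

/-- For the generator `B` of `R` the transform `G` of the reversed group satisfies `B G = I - G`;
`Λ` carries this over to the generator of `W`. -/
theorem hasGenerator_laplaceAtOne {E : Type*} [NormedAddCommGroup E] [InnerProductSpace ℂ E]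
    [CompleteSpace E] {R : ℝ → E ≃ₗᵢ[ℂ] E} (hR : IsUnitaryGroup R) {Λ : E →L[ℂ] H}
    (hΛ : ∀ t : ℝ≥0, Λ ∈ intertwiningSet (toCLM (R t)) (W t)) (k : E) :
    HasGenerator W (Λ (laplaceAtOne (fun t => R (-t)) k))
      (Λ (k - laplaceAtOne (fun t => R (-t)) k)) := by
  set x := laplaceAtOne (fun t => R (-t)) k with hx
  -- The base point is written `-0` to fit the chain rule with `t ↦ -t`.
  have h1 : HasDerivAt (fun t => R (-t) x) (R (-0) (x - k)) (-0) := by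
    rw [neg_zero]
    have := hR.comp_neg.hasDerivAt_laplaceAtOne 0 k
    rwa [neg_zero] at this
  have h2 : HasDerivAt (fun t => R t x) (k - x) 0 := by
    have := h1.scomp 0 (hasDerivAt_neg (0 : ℝ))
    simpa [Function.comp_def, hR.map_zero] using this
  have h3 := ((Λ.restrictScalars ℝ).hasFDerivAt.comp_hasDerivAt 0 h2).tendsto_slope_zero_right
  have h4 : Tendsto (fun t : ℝ≥0 => (t : ℝ)) (𝓝[>] 0) (𝓝[>] 0) :=
    NNReal.continuous_coe.continuousWithinAt.tendsto_nhdsWithin fun t ht => by simpa using ht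
  refine (h3.comp h4).congr fun t => ?_
  have h5 : Λ (R t x) = W t (Λ x) := DFunLike.congr_fun (hΛ t) x
  simp only [Function.comp_apply, ContinuousLinearMap.coe_restrictScalars', zero_add,
    hR.map_zero, h5]
  exact (RCLike.real_smul_eq_coe_smul (K := ℂ) _ _).trans (by simp)

/-- A semigroup with a unitary quasi-affine transform is of class `C_{·1}`. -/
theorem IsUnitaryQuasiAffineTransform.isClassCDotOne [CompleteSpace H] {H' : Type*} [NormedAddCommGroup H']
    [InnerProductSpace ℂ H'] [CompleteSpace H'] {U' : ℝ → H' ≃ₗᵢ[ℂ] H'}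
    (hU : IsUnitaryQuasiAffineTransform U' W) : IsClassCDotOne W := by
  obtain ⟨-, Λ, ⟨-, hd⟩, hint⟩ := hU
  intro h hne hlim
  have h1 : ∀ t, ‖Λ.adjoint h‖ = ‖Λ.adjoint ((W t).adjoint h)‖ := by
    intro t
    have h2 : ∀ x, Λ (U' t x) = W t (Λ x) := fun x => DFunLike.congr_fun (hint t) x
    -- The adjoint of the intertwining relation, with the adjoint of `U' t` being its inverse.
    have h3 : Λ.adjoint ((W t).adjoint h) = (U' t).symm (Λ.adjoint h) := by
      refine ext_inner_right ℂ fun x => ?_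
      rw [ContinuousLinearMap.adjoint_inner_left, ContinuousLinearMap.adjoint_inner_left, ← h2,
        ← (U' t).inner_map_map, LinearIsometryEquiv.apply_symm_apply,
        ContinuousLinearMap.adjoint_inner_left]
    rw [h3, LinearIsometryEquiv.norm_map]
  have h4 : Tendsto (fun t => ‖Λ.adjoint ((W t).adjoint h)‖) atTop (𝓝 ‖Λ.adjoint 0‖) :=
    ((Λ.adjoint.continuous.tendsto 0).comp hlim).norm
  simp only [← h1, _root_.map_zero, norm_zero] at h4
  have h5 : Λ.adjoint h = 0 := norm_eq_zero.1 (tendsto_nhds_unique tendsto_const_nhds h4)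
  refine hne (hd.eq_zero_of_inner_left ℂ fun x => ?_)
  rw [← ContinuousLinearMap.adjoint_inner_left, h5, inner_zero_left]

variable [CompleteSpace H] [CompleteSpace K]

theorem IsMinimalUnitaryDilation.adjoint_apply (hU : IsMinimalUnitaryDilation W U J)
    (t : ℝ≥0) (h : H) : J.toContinuousLinearMap.adjoint (U t (J h)) = W t h := by
  refine ext_inner_left ℂ fun h' => ?_
  rw [ContinuousLinearMap.adjoint_inner_right]
  exact hU.dilation t h h'

/-- The projection onto `H` intertwines the minimal isometric dilation with the semigroup. -/
theorem IsMinimalUnitaryDilation.adjoint_apply_of_mem (hW : IsContractionSemigroup W)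
    (hU : IsMinimalUnitaryDilation W U J) (t : ℝ≥0) {k : K} (hk : k ∈ isometricSpace U J) :
    J.toContinuousLinearMap.adjoint (U t k) = W t (J.toContinuousLinearMap.adjoint k) := by
  let P := J.toContinuousLinearMap.adjoint
  have hle : isometricSpace U J ≤ LinearMap.ker (P ∘L toCLM (U t) - W t ∘L P).toLinearMap := by
    refine Submodule.topologicalClosure_minimal _ (Submodule.span_le.2 ?_)
      (ContinuousLinearMap.isClosed_ker _)
    rintro _ ⟨s, h, rfl⟩
    have h1 : P (U t (U s (J h))) = W t (P (U s (J h))) := by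
      rw [← hU.isUnitaryGroup.map_add, ← NNReal.coe_add, hU.adjoint_apply, hU.adjoint_apply,
        hW.map_add]
      rfl
    simpa [sub_eq_zero] using h1
  simpa [sub_eq_zero, P] using hle hk

theorem IsMinimalUnitaryDilation.residualProjection_mem (hW : IsContractionSemigroup W)
    (hU : IsMinimalUnitaryDilation W U J) (t : ℝ≥0) : residualProjection U J ∈
      intertwiningSet (toCLM (residualGroup hU.isUnitaryGroup J t)) (W t) := by
  refine ContinuousLinearMap.ext fun k => ?_
  exact hU.adjoint_apply_of_mem hW t (residualSpace_le_isometricSpace hU.isUnitaryGroup k.2)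

/-- Identifies `U t (J (W_t* h))`, which lies in `U t K₊`, as the orthogonal projection of `J h`
onto that space. -/
theorem IsMinimalUnitaryDilation.inner_adjoint (hW : IsContractionSemigroup W)
    (hU : IsMinimalUnitaryDilation W U J) (t : ℝ≥0) (h : H) {k : K}
    (hk : (U t).symm k ∈ isometricSpace U J) :
    inner ℂ (U t (J ((W t).adjoint h))) k = inner ℂ (J h) k := by
  obtain ⟨k, rfl⟩ := (U t).surjective k
  rw [LinearIsometryEquiv.symm_apply_apply] at hk
  have h1 := hU.adjoint_apply_of_mem hW t hk
  rw [(U t).inner_map_map]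
  calc inner ℂ (J ((W t).adjoint h)) k
      = inner ℂ ((W t).adjoint h) (J.toContinuousLinearMap.adjoint k) :=
        (ContinuousLinearMap.adjoint_inner_right J.toContinuousLinearMap _ k).symm
    _ = inner ℂ h (W t (J.toContinuousLinearMap.adjoint k)) :=
        ContinuousLinearMap.adjoint_inner_left _ _ _
    _ = inner ℂ h (J.toContinuousLinearMap.adjoint (U t k)) := by rw [h1]
    _ = _ := ContinuousLinearMap.adjoint_inner_right J.toContinuousLinearMap _ _

/-- If `J h` is orthogonal to the residual space, then `(W t)* h` tends to `0`. -/
theorem IsMinimalUnitaryDilation.tendsto_adjoint (hW : IsContractionSemigroup W)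
    (hU : IsMinimalUnitaryDilation W U J) {h : H} (hh : J h ∈ (residualSpace U J)ᗮ) :
    Tendsto (fun t => (W t).adjoint h) atTop (𝓝 0) := by
  set q : ℝ≥0 → K := fun t => U t (J ((W t).adjoint h)) with hq
  have hqn : ∀ t, ‖q t‖ = ‖(W t).adjoint h‖ := fun t => by
    rw [hq, LinearIsometryEquiv.norm_map, LinearIsometry.norm_map]
  have hJq : ∀ t, inner ℂ (J h) (q t) = (‖q t‖ : ℂ) ^ 2 := fun t => by
    rw [← hU.inner_adjoint hW t h (hU.symm_apply_mem le_rfl _)]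
    exact inner_self_eq_norm_sq_to_K (𝕜 := ℂ) (q t)
  -- Pythagoras for projections onto decreasing subspaces: `q s` lies in `U s K₊ ⊆ U t K₊`.
  have hdist : ∀ t s, t ≤ s → ‖q t - q s‖ ^ 2 = ‖q t‖ ^ 2 - ‖q s‖ ^ 2 := fun t s hts => by
    have h1 : inner ℂ (q t) (q s) = (‖q s‖ : ℂ) ^ 2 := by
      rw [← hJq s]
      exact hU.inner_adjoint hW t h (hU.symm_apply_mem hts _)
    rw [@norm_sub_sq ℂ, h1]
    norm_cast
    rw [RCLike.re_to_complex, Complex.ofReal_re]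
    ring
  have hanti : Antitone fun t => ‖q t‖ ^ 2 := fun t s hts => by
    have := hdist t s hts
    nlinarith [sq_nonneg ‖q t - q s‖]
  have hlim := tendsto_atTop_ciInf hanti ⟨0, by rintro _ ⟨t, rfl⟩; exact sq_nonneg _⟩
  have hcauchy : CauchySeq q := by
    rw [Metric.cauchySeq_iff']
    intro ε hε
    have h2 := Metric.cauchySeq_iff'.1 hlim.cauchySeq (ε ^ 2) (by positivity)
    obtain ⟨N, hN⟩ := h2
    refine ⟨N, fun n hn => ?_⟩
    have h3 := hN n hn
    rw [Real.dist_eq, abs_sub_comm] at h3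
    rw [dist_comm, dist_eq_norm]
    refine lt_of_pow_lt_pow_left₀ 2 hε.le ?_
    rw [hdist N n hn]
    exact (le_abs_self _).trans_lt h3
  obtain ⟨k, hk⟩ := cauchySeq_tendsto_of_complete hcauchy
  have hkR : k ∈ residualSpace U J := by
    rw [mem_residualSpace]
    intro t
    refine (Submodule.isClosed_topologicalClosure _).mem_of_tendsto
      (((U t).symm.continuous.tendsto k).comp hk) ?_
    filter_upwards [eventually_ge_atTop t] with s hs
    exact hU.symm_apply_mem hs _
  have h4 : Tendsto (fun t => inner ℂ (J h) (q t)) atTop (𝓝 (inner ℂ (J h) k)) :=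
    tendsto_const_nhds.inner hk
  rw [Submodule.inner_left_of_mem_orthogonal hkR hh] at h4
  rw [tendsto_zero_iff_norm_tendsto_zero]
  have h5 : Tendsto (fun t => √‖inner ℂ (J h) (q t)‖) atTop (𝓝 √‖(0 : ℂ)‖) :=
    (Real.continuous_sqrt.tendsto _).comp h4.norm
  rw [norm_zero, Real.sqrt_zero] at h5
  refine h5.congr fun t => ?_
  rw [hJq, norm_pow, Complex.norm_real, norm_norm, Real.sqrt_sq (norm_nonneg _), hqn]

/-- A vector `h` orthogonal to the range has `J h` orthogonal to the residual space. -/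
theorem IsMinimalUnitaryDilation.denseRange_residualProjection (hW : IsContractionSemigroup W)
    (hU : IsMinimalUnitaryDilation W U J) (h1 : IsClassCDotOne W) :
    DenseRange (residualProjection U J) := by
  have : Dense ((LinearMap.range (residualProjection U J).toLinearMap : Submodule ℂ H) : Set H) := by
    rw [Submodule.dense_iff_topologicalClosure_eq_top, Submodule.topologicalClosure_eq_top_iff,
      Submodule.eq_bot_iff]
    intro h hh
    by_contra hne
    refine h1 h hne (hU.tendsto_adjoint hW ?_)
    rw [Submodule.mem_orthogonal]
    intro k hk
    refine Eq.trans ?_ ((Submodule.mem_orthogonal _ _).1 hh _ ⟨⟨k, hk⟩, rfl⟩)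
    exact (ContinuousLinearMap.adjoint_inner_left J.toContinuousLinearMap h k).symm
  exact this

/-- Such a `k` is orthogonal to every `U t (J h)`, `t ∈ ℝ`, and these are total by minimality. -/
theorem IsMinimalUnitaryDilation.eq_zero_of_forall_adjoint (hU : IsMinimalUnitaryDilation W U J)
    {k : K} (hk : ∀ t, J.toContinuousLinearMap.adjoint (U t k) = 0) : k = 0 := by
  have hle : (Submodule.span ℂ {k : K | ∃ (t : ℝ) (h : H), k = U t (J h)}).topologicalClosure ≤
      (Submodule.span ℂ {k})ᗮ := by
    refine Submodule.topologicalClosure_minimal _ (Submodule.span_le.2 ?_)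
      (Submodule.isClosed_orthogonal _)
    rintro _ ⟨t, h, rfl⟩
    rw [SetLike.mem_coe, Submodule.mem_orthogonal_singleton_iff_inner_right]
    have h1 := hU.isUnitaryGroup.inner_apply_left (-t) k (J h)
    rw [neg_neg] at h1
    rw [← h1]
    have h2 := ContinuousLinearMap.adjoint_inner_left J.toContinuousLinearMap h (U (-t) k)
    rw [hk, inner_zero_left] at h2
    exact h2.symm
  rw [hU.minimal] at hle
  have := hle (Submodule.mem_top (x := k))
  rw [Submodule.mem_orthogonal_singleton_iff_inner_right] at this
  exact inner_self_eq_zero.1 this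

theorem IsMinimalUnitaryDilation.injective_residualProjection (hW : IsContractionSemigroup W)
    (hU : IsMinimalUnitaryDilation W U J) {C : H →L[ℂ] H} (hC : IsCogenerator W C)
    (hker : LinearMap.ker C.toLinearMap = ⊥) :
    Function.Injective (residualProjection U J) := by
  set Λ := residualProjection U J with hΛ
  set R := residualGroup hU.isUnitaryGroup J with hR
  have hRG : IsUnitaryGroup R := isUnitaryGroup_residualGroup _ _
  have hint := hU.residualProjection_mem hW
  refine (injective_iff_map_eq_zero Λ).2 fun k hk => ?_
  have hclosed : IsClosed (LinearMap.ker Λ.toLinearMap : Set (residualSpace U J)) :=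
    ContinuousLinearMap.isClosed_ker Λ
  have : CompleteSpace (LinearMap.ker Λ.toLinearMap) := hclosed.completeSpace_coe
  have hinv : ∀ t, R (-t) k ∈ LinearMap.ker Λ.toLinearMap := by
    intro t
    -- For the reversed group `t ↦ R (-t)` the backward part is `R t`, `t ≥ 0`, which preserves the
    -- kernel by intertwining.
    refine hRG.comp_neg.apply_mem_of_laplaceAtOne_mem (LinearMap.ker Λ.toLinearMap) ?_ ?_ t hk
    · intro t ht x hx
      have h1 : Λ (R t x) = W t.toNNReal (Λ x) := by
        have := DFunLike.congr_fun (hint t.toNNReal) x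
        rwa [Real.coe_toNNReal t ht] at this
      have h2 : Λ x = 0 := hx
      rw [h2, _root_.map_zero] at h1
      simpa using h1
    · intro x hx
      have h1 := hasGenerator_laplaceAtOne hRG hint x
      have h2 : Λ x = 0 := hx
      rw [_root_.map_sub, h2, zero_sub] at h1
      exact hC.eq_zero_of_hasGenerator_neg hker h1
  refine Subtype.ext (hU.eq_zero_of_forall_adjoint fun t => ?_)
  have := hinv (-t)
  rw [neg_neg] at this
  exact this

/-- The residual projection of a minimal unitary dilation is a quasi-affinity. -/
theorem IsMinimalUnitaryDilation.isQuasiAffinity_residualProjection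
    (hW : IsContractionSemigroup W) (hU : IsMinimalUnitaryDilation W U J) {C : H →L[ℂ] H}
    (hC : IsCogenerator W C) (hker : LinearMap.ker C.toLinearMap = ⊥) (h1 : IsClassCDotOne W) :
    IsQuasiAffinity (residualProjection U J) :=
  ⟨hU.injective_residualProjection hW hC hker, hU.denseRange_residualProjection hW h1⟩

/-- The residual group of a minimal unitary dilation is a unitary quasi-affine transform. -/
theorem IsMinimalUnitaryDilation.isUnitaryQuasiAffineTransform_residualGroup
    (hW : IsContractionSemigroup W) (hU : IsMinimalUnitaryDilation W U J) {C : H →L[ℂ] H}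
    (hC : IsCogenerator W C) (hker : LinearMap.ker C.toLinearMap = ⊥) (h1 : IsClassCDotOne W) :
    IsUnitaryQuasiAffineTransform (residualGroup hU.isUnitaryGroup J) W :=
  ⟨isUnitaryGroup_residualGroup _ _, residualProjection U J,
    hU.isQuasiAffinity_residualProjection hW hC hker h1, hU.residualProjection_mem hW⟩

end Residual

end QuasiAffine

theorem theorem2p1 {H : Type u} [NormedAddCommGroup H] [InnerProductSpace ℂ H]
    [CompleteSpace H] (W : ℝ≥0 → H →L[ℂ] H) (hW : QuasiAffine.IsContractionSemigroup W)
    (C : H →L[ℂ] H) (hC : QuasiAffine.IsCogenerator W C) (hker : LinearMap.ker C.toLinearMap = ⊥) :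
    ((∃ (H' : Type u) (_ : NormedAddCommGroup H') (_ : InnerProductSpace ℂ H')
        (_ : CompleteSpace H') (U' : ℝ → H' ≃ₗᵢ[ℂ] H'),
        QuasiAffine.IsUnitaryQuasiAffineTransform U' W) ↔ QuasiAffine.IsClassCDotOne W) ∧
    (QuasiAffine.IsClassCDotOne W →
      (∃ (K : Type u) (_ : NormedAddCommGroup K) (_ : InnerProductSpace ℂ K)
        (_ : CompleteSpace K) (U : ℝ → K ≃ₗᵢ[ℂ] K) (J : H →ₗᵢ[ℂ] K),
        QuasiAffine.IsMinimalUnitaryDilation W U J) ∧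
      ∀ (K : Type v) [NormedAddCommGroup K] [InnerProductSpace ℂ K] [CompleteSpace K]
        (U : ℝ → K ≃ₗᵢ[ℂ] K) (J : H →ₗᵢ[ℂ] K) (hU : QuasiAffine.IsMinimalUnitaryDilation W U J),
        QuasiAffine.IsUnitaryQuasiAffineTransform
          (QuasiAffine.residualGroup hU.isUnitaryGroup J) W ∧
        QuasiAffine.IsQuasiAffinity (QuasiAffine.residualProjection U J) ∧
        ∀ t : ℝ≥0, QuasiAffine.residualProjection U J ∈
          QuasiAffine.intertwiningSet
            (QuasiAffine.toCLM (QuasiAffine.residualGroup hU.isUnitaryGroup J t)) (W t)) := by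
  refine ⟨⟨?_, fun h1 => ?_⟩, fun h1 => ⟨hW.exists_isMinimalUnitaryDilation, ?_⟩⟩
  · rintro ⟨H', _, _, _, U', hU'⟩
    exact hU'.isClassCDotOne
  · obtain ⟨K, _, _, _, U, J, hU⟩ := hW.exists_isMinimalUnitaryDilation
    exact ⟨QuasiAffine.residualSpace U J, inferInstance, inferInstance, inferInstance,
      QuasiAffine.residualGroup hU.isUnitaryGroup J,
      hU.isUnitaryQuasiAffineTransform_residualGroup hW hC hker h1⟩
  · intro K _ _ _ U J hU
    exact ⟨hU.isUnitaryQuasiAffineTransform_residualGroup hW hC hker h1,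
      hU.isQuasiAffinity_residualProjection hW hC hker h1, hU.residualProjection_mem hW⟩
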